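/- An integral polytope in $\mathbb{R}^d$ is the convex hull of a finite nonempty set of points of $\mathbb{Z}^d$. An integral polytope $Q\subset\mathbb{R}^d$ is reflexive if the origin lies in its interior and its polar dual $Q^\vee=\{x\in\mathbb{R}^d:\langle x,y\rangle\ge -1\text{ for all }y\in Q\}$ is also an integral polytope. The Ehrhart polynomial of $Q$ is the polynomial $E_Q$ with $E_Q(k)=\#(kQ\cap\mathbb{Z}^d)$ for all integers $k\ge 0$. A reflexive polytope $Q$ is called CL if every complex root $z$ of $E_Q$ satisfies $\mathrm{Re}(z)=-\tfrac12$. For $Q_1\subset\mathbb{R}^{a}$ and $Q_2\subset\mathbb{R}^{b}$ containing the origin, the free sum is $$Q_1\oplus Q_2=\mathrm{conv}\big((Q_1\times\{0\})\cup(\{0\}\times Q_2)\big)\subset\mathbb{R}^{a}\times\mathbb{R}^{b}=\mathbb{R}^{a+b},$$ and $Q^{\oplus n}$ denotes the $n$-fold free sum $Q\oplus\cdots\oplus Q$. For $d\ge1$ let $$A_d=\mathrm{conv}\{\pm(e_i+e_{i+1}+\cdots+e_j):1\le i\le j\le d\}\subset\mathbb{R}^d$$ be the classical root polytope of type A, where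 $e_1,\dots,e_d$ is the standard basis of $\mathbb{R}^d$. **Proposition.** For every integer $n\ge 1$, the polytope $A_2\oplus A_1^{\oplus n}\subset\mathbb{R}^{n+2}$ is CL; that is, it is reflexive and all complex roots of its Ehrhart polynomial lie on the line $\mathrm{Re}(z)=-\tfrac12$. -/

import Mathlib

open scoped Pointwise

namespace EhrhartCL

noncomputable section

/-- The inclusion of the integer lattice `ℤ^d` into `ℝ^d`. -/
def latticePoint {d : ℕ} (z : Fin d → ℤ) : Fin d → ℝ := fun i => (z i : ℝ)

/-- An integral polytope in `ℝ^d`: the convex hull of finitely many lattice points. -/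
def IsIntegralPolytope {d : ℕ} (Q : Set (Fin d → ℝ)) : Prop :=
  ∃ V : Finset (Fin d → ℤ), V.Nonempty ∧ Q = convexHull ℝ (latticePoint '' (V : Set (Fin d → ℤ)))

/-- The polar dual `Q^∨ = {x : ⟨x, y⟩ ≥ -1 for all y ∈ Q}`. -/
def polarDual {d : ℕ} (Q : Set (Fin d → ℝ)) : Set (Fin d → ℝ) :=
  {x | ∀ y ∈ Q, -1 ≤ ∑ i, x i * y i}

/-- A reflexive polytope: an integral polytope with the origin in its interior whose polar dual
is again an integral polytope. -/
structure IsReflexive {d : ℕ} (Q : Set (Fin d → ℝ)) : Prop where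
  integral : IsIntegralPolytope Q
  zero_mem_interior : (0 : Fin d → ℝ) ∈ interior Q
  dual_integral : IsIntegralPolytope (polarDual Q)

/-- The number `#(kQ ∩ ℤ^d)` of lattice points of the dilate `kQ`. -/
def latticeCount {d : ℕ} (Q : Set (Fin d → ℝ)) (k : ℕ) : ℕ :=
  {z : Fin d → ℤ | latticePoint z ∈ (k : ℝ) • Q}.ncard

/-- `E` is the Ehrhart polynomial of `Q`: `E(k) = #(kQ ∩ ℤ^d)` for all `k = 0, 1, 2, …`. -/
def IsEhrhartPolynomial {d : ℕ} (Q : Set (Fin d → ℝ)) (E : Polynomial ℚ) : Prop :=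
  ∀ k : ℕ, E.eval (k : ℚ) = (latticeCount Q k : ℚ)

/-- A set has at most one Ehrhart polynomial. -/
theorem IsEhrhartPolynomial.unique {d : ℕ} {Q : Set (Fin d → ℝ)} {E F : Polynomial ℚ}
    (hE : IsEhrhartPolynomial Q E) (hF : IsEhrhartPolynomial Q F) : E = F := by
  refine Polynomial.eq_of_infinite_eval_eq E F
    ((Set.infinite_range_of_injective (Nat.cast_injective (R := ℚ))).mono ?_)
  rintro _ ⟨k, rfl⟩
  exact (hE k).trans (hF k).symm

/-- `Q` is CL: it is reflexive, and all complex roots of its Ehrhart polynomial lie on the line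
`Re z = -1/2`. -/
def IsCL {d : ℕ} (Q : Set (Fin d → ℝ)) : Prop :=
  IsReflexive Q ∧ ∃ E : Polynomial ℚ, IsEhrhartPolynomial Q E ∧
    ∀ z : ℂ, Polynomial.aeval z E = 0 → z.re = -1 / 2

/-- The free sum `P ⊕ Q = conv ((P × 0) ∪ (0 × Q))` in `ℝ^a × ℝ^b = ℝ^(a+b)`. -/
def freeSum {a b : ℕ} (P : Set (Fin a → ℝ)) (Q : Set (Fin b → ℝ)) : Set (Fin (a + b) → ℝ) :=
  convexHull ℝ (((fun x : Fin a → ℝ => Fin.append x (0 : Fin b → ℝ)) '' P) ∪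
    ((fun y : Fin b → ℝ => Fin.append (0 : Fin a → ℝ) y) '' Q))

/-- The `n`-fold free sum `Q ⊕ ⋯ ⊕ Q`; the empty free sum is the one-point polytope
`ℝ^0 = {0}`, which is neutral for `freeSum`. -/
def freeSumPow {d : ℕ} (Q : Set (Fin d → ℝ)) : (n : ℕ) → Set (Fin (d * n) → ℝ)
  | 0 => {0}
  | n + 1 => freeSum (freeSumPow Q n) Q

/-- The classical root polytope of type A,
`A_d = conv {± (e_i + ⋯ + e_j) : 1 ≤ i ≤ j ≤ d}`, for `d ≥ 1`. -/
def rootPolytopeA (d : ℕ) : Set (Fin d → ℝ) :=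
  convexHull ℝ {v | ∃ i j : Fin d, i ≤ j ∧
    (v = ∑ l ∈ Finset.Icc i j, Pi.single l (1 : ℝ) ∨
      v = -∑ l ∈ Finset.Icc i j, Pi.single l (1 : ℝ))}

end

end EhrhartCL

/-! Let `C_n` be the Ehrhart polynomial of the `n`-dimensional cross-polytope, with generating
series `(1+t)^n/(1-t)^(n+1)`. The hexagon has numerator `1+4t+t² = (3/2)(1+t)² - (1/2)(1-t)²`, and
each free sum with a segment multiplies it by `1+t`; so the Ehrhart polynomial sought is
`(3/2)C_{n+2} - (1/2)C_n`, that is `hexCrossPoly n`.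

Roots: the three-term recurrence for `C_n` shows inductively that off the line `Re z = -1/2` the
ratio `C_{n+1}/C_n` has real part of the sign of `Re(2z+1)` (`crossPoly_ratio_re`). At a root,
eliminating `C_{n+2}` leaves `3(2z+1) + (2n+1)C_n/C_{n+1} = 0`, impossible when both terms have real
parts of the same strict sign.

Counting: gauges add under free sums (`IsLatticeGauge.freeSum`), so lattice points are counted by
sublevel sets of `hexGauge + Σ|z_i|`. Adding a summand `|j|` gives the difference equation
`F_{n+1}(k+1) = F_{n+1}(k) + F_n(k+1) + F_n(k)`, which `hexCrossPoly` also satisfies. Reflexivity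
passes to free sums because the polar dual of a free sum is the product of the duals. -/

namespace EhrhartCL

/-! ### Cross polynomials and the location of roots -/

open Polynomial

noncomputable section

/-- The Ehrhart polynomials of the cross-polytopes, by their three-term recurrence. -/
def crossPoly : ℕ → ℚ[X]
  | 0 => 1
  | 1 => 2 * X + 1
  | n + 2 => C ((n + 2 : ℚ)⁻¹) * ((2 * X + 1) * crossPoly (n + 1) + C (n + 1 : ℚ) * crossPoly n)

theorem crossPoly_recurrence {K : Type*} [Field K] [Algebra ℚ K] (n : ℕ) (x : K) :
    (n + 2 : K) * aeval x (crossPoly (n + 2)) =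
      (2 * x + 1) * aeval x (crossPoly (n + 1)) + (n + 1) * aeval x (crossPoly n) := by
  have : CharZero K := algebraRat.charZero K
  have h : (n + 2 : K) ≠ 0 := by exact_mod_cast (by omega : n + 2 ≠ 0)
  rw [crossPoly]
  simp only [map_mul, map_add, aeval_C, aeval_X, map_inv₀, map_natCast, map_ofNat, map_one]
  rw [mul_inv_cancel_left₀ h]

/-- The first identity is `(1-t)G_{n+1} = (1+t)G_n` for the generating series. It does not close
under induction alone; the second identity is what its inductive step needs, and is itself recovered
from the first and the recurrence. -/
theorem crossPoly_difference (n : ℕ) (x : ℚ) :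
    (crossPoly (n + 1)).eval (x + 1) - (crossPoly (n + 1)).eval x =
        (crossPoly n).eval (x + 1) + (crossPoly n).eval x ∧
      (2 * x + 2) * ((crossPoly (n + 1)).eval (x + 1) - (crossPoly (n + 1)).eval x) -
        (n + 1) * ((crossPoly (n + 1)).eval (x + 1) + (crossPoly (n + 1)).eval x) +
        (n + 1) * ((crossPoly n).eval (x + 1) - (crossPoly n).eval x) = 0 := by
  induction n with
  | zero => constructor <;> simp [crossPoly] <;> ring
  | succ n ih =>
    obtain ⟨h₁, h₂⟩ := ih
    have hr := crossPoly_recurrence n x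
    have hr' := crossPoly_recurrence n (x + 1)
    simp only [coe_aeval_eq_eval] at hr hr'
    have h : (n + 2 : ℚ) ≠ 0 := by positivity
    have key : (crossPoly (n + 2)).eval (x + 1) - (crossPoly (n + 2)).eval x =
        (crossPoly (n + 1)).eval (x + 1) + (crossPoly (n + 1)).eval x := by
      apply mul_left_cancel₀ h
      linear_combination hr' - hr + h₂
    refine ⟨key, ?_⟩
    push_cast
    linear_combination (2 * x + 2) * key - hr' - hr + (n + 1) * h₁

theorem crossPoly_eval_zero (n : ℕ) : (crossPoly n).eval 0 = 1 := by
  induction n using Nat.twoStepInduction with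
  | zero => simp [crossPoly]
  | one => simp [crossPoly]
  | more n h₀ h₁ =>
    have hr := crossPoly_recurrence n (0 : ℚ)
    simp only [coe_aeval_eq_eval, h₀, h₁] at hr
    have h : (n + 2 : ℚ) ≠ 0 := by positivity
    apply mul_left_cancel₀ h
    linear_combination hr

/-- If `Re (2z+1)` has the sign of `σ`, consecutive cross polynomials do not vanish at `z`, and
their ratio has real part of the same sign. -/
theorem crossPoly_ratio_re {σ : ℝ} {z : ℂ} (hz : 0 < σ * (2 * z + 1).re) (n : ℕ) :
    aeval z (crossPoly n) ≠ 0 ∧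
      0 < σ * (aeval z (crossPoly (n + 1)) / aeval z (crossPoly n)).re := by
  induction n with
  | zero =>
    have h₁ : aeval z (crossPoly 1) = 2 * z + 1 := by
      simp only [crossPoly, map_add, map_mul, aeval_X, map_ofNat, map_one]
    have h₀ : aeval z (crossPoly 0) = 1 := map_one _
    rw [h₁, h₀, div_one]
    exact ⟨one_ne_zero, hz⟩
  | succ n ih =>
    obtain ⟨h₀, h₁⟩ := ih
    have hne : aeval z (crossPoly (n + 1)) ≠ 0 := by
      intro h
      simp [h] at h₁
    refine ⟨hne, ?_⟩
    have hr := crossPoly_recurrence n z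
    -- Inversion keeps the sign of the real part, so after division by `C_{n+1}` both terms of the
    -- recurrence have the same sign.
    have hinv : 0 < σ * (aeval z (crossPoly n) / aeval z (crossPoly (n + 1))).re := by
      rw [← inv_div, Complex.inv_re, ← mul_div_assoc]
      exact div_pos h₁ (Complex.normSq_pos.2 (div_ne_zero hne h₀))
    have hratio : ((n + 2 : ℝ) : ℂ) *
        (aeval z (crossPoly (n + 1 + 1)) / aeval z (crossPoly (n + 1))) = (2 * z + 1) +
          ((n + 1 : ℝ) : ℂ) * (aeval z (crossPoly n) / aeval z (crossPoly (n + 1))) := by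
      field_simp
      push_cast
      linear_combination hr
    have hre := congrArg Complex.re hratio
    rw [Complex.re_ofReal_mul, Complex.add_re, Complex.re_ofReal_mul] at hre
    have hn : (0 : ℝ) < n + 2 := by positivity
    refine pos_of_mul_pos_right (a := (n + 2 : ℝ)) ?_ hn.le
    calc (0 : ℝ) < σ * (2 * z + 1).re + (n + 1 : ℝ) *
          (σ * (aeval z (crossPoly n) / aeval z (crossPoly (n + 1))).re) := by positivity
      _ = _ := by linear_combination -σ * hre

/-- The Ehrhart polynomial of the free sum of a hexagon and an `n`-dimensional cross-polytope. -/
def hexCrossPoly (n : ℕ) : ℚ[X] := C (3 / 2) * crossPoly (n + 2) - C (1 / 2) * crossPoly n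

theorem hexCrossPoly_difference (n : ℕ) (x : ℚ) :
    (hexCrossPoly (n + 1)).eval (x + 1) =
      (hexCrossPoly (n + 1)).eval x + (hexCrossPoly n).eval (x + 1) + (hexCrossPoly n).eval x := by
  have h₁ := (crossPoly_difference n x).1
  have h₂ := (crossPoly_difference (n + 2) x).1
  simp only [hexCrossPoly, eval_sub, eval_mul, eval_C]
  linear_combination 3 / 2 * h₂ - 1 / 2 * h₁

theorem hexCrossPoly_eval_zero (n : ℕ) : (hexCrossPoly n).eval 0 = 1 := by
  simp only [hexCrossPoly, eval_sub, eval_mul, eval_C, crossPoly_eval_zero]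
  norm_num

theorem hexCrossPoly_zero_eval (x : ℚ) : (hexCrossPoly 0).eval x = 3 * x ^ 2 + 3 * x + 1 := by
  simp [hexCrossPoly, crossPoly]
  ring

theorem hexCrossPoly_root_re (n : ℕ) {z : ℂ} (hz : aeval z (hexCrossPoly n) = 0) :
    z.re = -1 / 2 := by
  by_contra hne
  have hw : (2 * z + 1).re ≠ 0 := by
    intro h
    apply hne
    simp at h
    linarith
  -- Taking `σ = Re(2z+1)` treats both open half-planes at once.
  have hpos : 0 < (2 * z + 1).re * (2 * z + 1).re := mul_self_pos.2 hw
  obtain ⟨h₀, h₁⟩ := crossPoly_ratio_re hpos n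
  have hne₁ := (crossPoly_ratio_re hpos (n + 1)).1
  have hinv : 0 < (2 * z + 1).re * (aeval z (crossPoly n) / aeval z (crossPoly (n + 1))).re := by
    rw [← inv_div, Complex.inv_re, ← mul_div_assoc]
    exact div_pos h₁ (Complex.normSq_pos.2 (div_ne_zero hne₁ h₀))
  have hr := crossPoly_recurrence n z
  have hE : 3 / 2 * aeval z (crossPoly (n + 2)) - 1 / 2 * aeval z (crossPoly n) = 0 := by
    simpa [hexCrossPoly] using hz
  have hratio : ((3 : ℝ) : ℂ) * (2 * z + 1) + ((2 * n + 1 : ℝ) : ℂ) *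
      (aeval z (crossPoly n) / aeval z (crossPoly (n + 1))) = 0 := by
    field_simp
    push_cast
    linear_combination (2 * (n + 2)) * hE - 3 * hr
  have hre := congrArg Complex.re hratio
  rw [Complex.add_re, Complex.re_ofReal_mul, Complex.re_ofReal_mul, Complex.zero_re] at hre
  have : 0 < 3 * ((2 * z + 1).re * (2 * z + 1).re) + (2 * n + 1 : ℝ) *
      ((2 * z + 1).re * (aeval z (crossPoly n) / aeval z (crossPoly (n + 1))).re) := by positivity
  have h0 : 3 * ((2 * z + 1).re * (2 * z + 1).re) + (2 * n + 1 : ℝ) *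
      ((2 * z + 1).re * (aeval z (crossPoly n) / aeval z (crossPoly (n + 1))).re) = 0 := by
    linear_combination (2 * z + 1).re * hre
  exact this.ne' h0

end

/-! ### Sublevel sets after adding a coordinate `|j|` -/

theorem finite_sublevel_add_natAbs {α : Type*} {h : α → ℕ} (hf : ∀ k, {a | h a ≤ k}.Finite)
    (k : ℕ) : {p : α × ℤ | h p.1 + p.2.natAbs ≤ k}.Finite := by
  refine ((hf k).prod (Set.finite_Icc (-(k : ℤ)) k)).subset ?_
  rintro ⟨a, j⟩ hp
  simp only [Set.mem_ofPred_eq, Set.mem_prod, Set.mem_Icc] at hp ⊢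
  omega

theorem ncard_sublevel_add_natAbs_zero {α : Type*} (h : α → ℕ) :
    {p : α × ℤ | h p.1 + p.2.natAbs ≤ 0}.ncard = {a | h a ≤ 0}.ncard := by
  rw [← Set.ncard_image_of_injective {a | h a ≤ 0} (Prod.mk_left_injective (0 : ℤ))]
  congr 1
  ext ⟨a, j⟩
  simp only [Set.mem_ofPred_eq, Set.mem_image, Prod.mk.injEq]
  constructor
  · intro hp
    exact ⟨a, by omega, rfl, by omega⟩
  · rintro ⟨a, ha, rfl, rfl⟩
    simpa using ha

/-- In each fibre, `φ` shifts the entries `j ≥ 0` up by one and fixes the negative ones. This misses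
`j = 0`, supplied by `ψ`, and the new negative endpoint `j = h a - (k+1)`, supplied by `χ` when `h a
≤ k`. -/
theorem ncard_sublevel_add_natAbs_succ {α : Type*} {h : α → ℕ} (hf : ∀ k, {a | h a ≤ k}.Finite)
    (k : ℕ) :
    {p : α × ℤ | h p.1 + p.2.natAbs ≤ k + 1}.ncard =
      {p : α × ℤ | h p.1 + p.2.natAbs ≤ k}.ncard + {a | h a ≤ k + 1}.ncard +
        {a | h a ≤ k}.ncard := by
  let φ : α × ℤ → α × ℤ := fun p => (p.1, if 0 ≤ p.2 then p.2 + 1 else p.2)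
  let ψ : α → α × ℤ := fun a => (a, 0)
  let χ : α → α × ℤ := fun a => (a, (h a : ℤ) - (k + 1))
  have hφ : φ.Injective := by
    rintro ⟨a, i⟩ ⟨b, j⟩ hab
    simp only [φ, Prod.mk.injEq] at hab ⊢
    refine ⟨hab.1, ?_⟩
    have := hab.2
    split_ifs at this <;> omega
  have hψ : ψ.Injective := fun a b hab => (Prod.mk.inj hab).1
  have hχ : χ.Injective := fun a b hab => (Prod.mk.inj hab).1
  rw [← Set.ncard_image_of_injective {p : α × ℤ | h p.1 + p.2.natAbs ≤ k} hφ,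
    ← Set.ncard_image_of_injective {a | h a ≤ k + 1} hψ,
    ← Set.ncard_image_of_injective {a | h a ≤ k} hχ,
    ← Set.ncard_union_eq ?_ ((finite_sublevel_add_natAbs hf k).image φ) ((hf _).image ψ),
    ← Set.ncard_union_eq ?_ (((finite_sublevel_add_natAbs hf k).image φ).union ((hf _).image ψ))
      ((hf _).image χ)]
  · congr 1
    ext ⟨a, j⟩
    simp only [Set.mem_ofPred_eq, Set.mem_union, Set.mem_image, Prod.exists, φ, ψ, χ, Prod.mk.injEq]
    constructor
    · intro hp
      rcases lt_trichotomy j 0 with hj | rfl | hj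
      · by_cases hk : h a + j.natAbs ≤ k
        · exact Or.inl (Or.inl ⟨a, j, hk, rfl, by rw [if_neg (by omega)]⟩)
        · exact Or.inr ⟨a, by omega, rfl, by omega⟩
      · exact Or.inl (Or.inr ⟨a, by omega, rfl, rfl⟩)
      · exact Or.inl (Or.inl ⟨a, j - 1, by omega, rfl, by rw [if_pos (by omega)]; omega⟩)
    · rintro ((⟨b, i, hi, rfl, rfl⟩ | ⟨b, hb, rfl, rfl⟩) | ⟨b, hb, rfl, rfl⟩)
      · split_ifs <;> omega
      · simpa using hb
      · omega
  · rw [Set.disjoint_left]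
    rintro ⟨a, j⟩ hp ⟨c, hc, hcj⟩
    simp only [Set.mem_ofPred_eq, Set.mem_union, Set.mem_image, Prod.exists, φ, ψ, χ,
      Prod.mk.injEq] at hp hc hcj
    obtain ⟨rfl, rfl⟩ := hcj
    rcases hp with ⟨b, i, hi, rfl, hij⟩ | ⟨b, hb, rfl, hij⟩
    · split_ifs at hij <;> omega
    · omega
  · rw [Set.disjoint_left]
    rintro ⟨a, j⟩ ⟨⟨b, i⟩, hi, hij⟩ ⟨c, hc, hcj⟩
    simp only [Set.mem_ofPred_eq, φ, ψ, Prod.mk.injEq] at hi hij hc hcj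
    obtain ⟨rfl, rfl⟩ := hcj
    have := hij.2
    split_ifs at this <;> omega

/-! ### Lattice points of the hexagon -/

/-- The lattice gauge of the hexagon `rootPolytopeA 2`. -/
def hexGauge (z : Fin 2 → ℤ) : ℕ := max (max (z 0).natAbs (z 1).natAbs) (z 0 - z 1).natAbs

/-- The slice at first coordinate `x` has `2k+1-|x|` points. Keeping `c` separate from `m` lets the
induction run with `c` fixed. -/
theorem sum_Icc_sub_natAbs (c : ℤ) (m : ℕ) :
    ∑ x ∈ Finset.Icc (-(m : ℤ)) m, (c - x.natAbs) = (2 * m + 1) * c - m * (m + 1) := by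
  induction m with
  | zero => simp
  | succ m ih =>
    have : Finset.Icc (-((m + 1 : ℕ) : ℤ)) ((m + 1 : ℕ) : ℤ) =
        insert (-((m + 1 : ℕ) : ℤ)) (insert ((m + 1 : ℕ) : ℤ) (Finset.Icc (-(m : ℤ)) m)) := by
      ext x
      simp only [Finset.mem_Icc, Finset.mem_insert]
      omega
    rw [this, Finset.sum_insert (by simp only [Finset.mem_Icc, Finset.mem_insert]; omega),
      Finset.sum_insert (by simp only [Finset.mem_Icc]; omega), ih, Int.natAbs_neg,
      Int.natAbs_natCast]
    push_cast
    ring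

theorem hexGauge_sublevel (k : ℕ) :
    {z | hexGauge z ≤ k} = (fun p : Sigma fun _ : ℤ => ℤ => (![p.1, p.2] : Fin 2 → ℤ)) ''
      ((Finset.Icc (-(k : ℤ)) k).sigma fun x => Finset.Icc (max (-(k : ℤ)) (x - k))
        (min (k : ℤ) (x + k)) : Finset (Sigma fun _ : ℤ => ℤ)) := by
  ext z
  simp only [hexGauge, Set.mem_ofPred_eq, Set.mem_image, Finset.mem_coe, Finset.mem_sigma,
    Finset.mem_Icc, Sigma.exists]
  constructor
  · intro h
    refine ⟨z 0, z 1, by omega, ?_⟩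
    ext i
    fin_cases i <;> rfl
  · rintro ⟨x, y, h, rfl⟩
    simp only [Matrix.cons_val_zero, Matrix.cons_val_one]
    omega

theorem finite_hexGauge_sublevel (k : ℕ) : {z | hexGauge z ≤ k}.Finite := by
  rw [hexGauge_sublevel]
  exact (Finset.finite_toSet _).image _

theorem ncard_hexGauge_sublevel (k : ℕ) :
    ({z | hexGauge z ≤ k}.ncard : ℤ) = 3 * k ^ 2 + 3 * k + 1 := by
  rw [hexGauge_sublevel, Set.ncard_image_of_injective, Set.ncard_coe_finset, Finset.card_sigma]
  · push_cast
    rw [Finset.sum_congr rfl (g := fun x : ℤ => (2 * k + 1 : ℤ) - x.natAbs),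
      sum_Icc_sub_natAbs]
    · ring
    · intro x hx
      rw [Finset.mem_Icc] at hx
      rw [Int.card_Icc]
      omega
  · rintro ⟨x, y⟩ ⟨x', y'⟩ h
    have h₀ := congrFun h 0
    have h₁ := congrFun h 1
    simp only [Matrix.cons_val_zero, Matrix.cons_val_one] at h₀ h₁
    rw [h₀, h₁]

/-! ### Free sums: integrality, duality, gauges -/

open Topology

/-- Concatenation of vectors as a linear map. -/
def appendLinear (a b : ℕ) : ((Fin a → ℝ) × (Fin b → ℝ)) →ₗ[ℝ] (Fin (a + b) → ℝ) where
  toFun p := Fin.append p.1 p.2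
  map_add' p q := by ext i; refine Fin.addCases ?_ ?_ i <;> simp
  map_smul' c p := by ext i; refine Fin.addCases ?_ ?_ i <;> simp

theorem latticePoint_append {a b : ℕ} (z : Fin a → ℤ) (w : Fin b → ℤ) :
    latticePoint (Fin.append z w) = Fin.append (latticePoint z) (latticePoint w) := by
  ext i
  refine Fin.addCases ?_ ?_ i <;> simp [latticePoint]

theorem latticePoint_zero {d : ℕ} : latticePoint (0 : Fin d → ℤ) = 0 := by
  ext i
  simp [latticePoint]

theorem IsIntegralPolytope.of_finite {d : ℕ} {Q : Set (Fin d → ℝ)} {V : Set (Fin d → ℤ)}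
    (hV : V.Finite) (hne : V.Nonempty) (hQ : Q = convexHull ℝ (latticePoint '' V)) :
    IsIntegralPolytope Q :=
  ⟨hV.toFinset, by simpa using hne, by simpa using hQ⟩

theorem IsIntegralPolytope.convex {d : ℕ} {Q : Set (Fin d → ℝ)} (hQ : IsIntegralPolytope Q) :
    Convex ℝ Q := by
  obtain ⟨V, -, rfl⟩ := hQ
  exact convex_convexHull ℝ _

theorem IsIntegralPolytope.freeSum {a b : ℕ} {P : Set (Fin a → ℝ)} {Q : Set (Fin b → ℝ)}
    (hP : IsIntegralPolytope P) (hQ : IsIntegralPolytope Q) :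
    IsIntegralPolytope (freeSum P Q) := by
  obtain ⟨V, hV, rfl⟩ := hP
  obtain ⟨W, hW, rfl⟩ := hQ
  have hl := ((appendLinear a b).comp (LinearMap.inl ℝ _ _)).image_convexHull
    (latticePoint '' (V : Set (Fin a → ℤ)))
  have hr := ((appendLinear a b).comp (LinearMap.inr ℝ _ _)).image_convexHull
    (latticePoint '' (W : Set (Fin b → ℤ)))
  refine .of_finite (V := (fun v => Fin.append v 0) '' (V : Set (Fin a → ℤ)) ∪
    (fun w => Fin.append 0 w) '' (W : Set (Fin b → ℤ)))
    ((V.finite_toSet.image _).union (W.finite_toSet.image _)) ?_ ?_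
  · exact (Set.Nonempty.image _ (by simpa using hV)).inl
  · unfold EhrhartCL.freeSum
    erw [hl, hr]
    rw [convexHull_convexHull_union_left, convexHull_convexHull_union_right]
    congr 1
    rw [Set.image_union, Set.image_image, Set.image_image, Set.image_image, Set.image_image]
    simp only [latticePoint_append, latticePoint_zero]
    rfl

theorem IsIntegralPolytope.appendLinear_image_prod {a b : ℕ} {P : Set (Fin a → ℝ)}
    {Q : Set (Fin b → ℝ)} (hP : IsIntegralPolytope P) (hQ : IsIntegralPolytope Q) :
    IsIntegralPolytope (appendLinear a b '' (P ×ˢ Q)) := by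
  obtain ⟨V, hV, rfl⟩ := hP
  obtain ⟨W, hW, rfl⟩ := hQ
  refine .of_finite (V := (fun p : (Fin a → ℤ) × (Fin b → ℤ) => Fin.append p.1 p.2) ''
    ((V : Set (Fin a → ℤ)) ×ˢ (W : Set (Fin b → ℤ))))
    ((V.finite_toSet.prod W.finite_toSet).image _) ?_ ?_
  · exact Set.Nonempty.image _ (Set.Nonempty.prod (by simpa using hV) (by simpa using hW))
  · rw [← convexHull_prod, LinearMap.image_convexHull, Set.prod_image_image_eq, Set.image_image,
      Set.image_image]
    simp only [latticePoint_append]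
    rfl

theorem append_left_mem_freeSum {a b : ℕ} {P : Set (Fin a → ℝ)} (Q : Set (Fin b → ℝ))
    {x : Fin a → ℝ} (hx : x ∈ P) : Fin.append x 0 ∈ freeSum P Q :=
  subset_convexHull ℝ _ (Or.inl ⟨x, hx, rfl⟩)

theorem append_right_mem_freeSum {a b : ℕ} (P : Set (Fin a → ℝ)) {Q : Set (Fin b → ℝ)}
    {y : Fin b → ℝ} (hy : y ∈ Q) : Fin.append 0 y ∈ freeSum P Q :=
  subset_convexHull ℝ _ (Or.inr ⟨y, hy, rfl⟩)

theorem polarDual_convexHull {d : ℕ} (S : Set (Fin d → ℝ)) :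
    polarDual (convexHull ℝ S) = {x | ∀ y ∈ S, -1 ≤ ∑ i, x i * y i} := by
  ext x
  refine ⟨fun h y hy => h y (subset_convexHull ℝ S hy), fun h => ?_⟩
  have hlin : IsLinearMap ℝ fun y : Fin d → ℝ => ∑ i, x i * y i :=
    ⟨fun y z => by simp [mul_add, Finset.sum_add_distrib],
      fun c y => by simp [Finset.mul_sum, mul_left_comm]⟩
  exact convexHull_min h (convex_halfSpace_ge hlin (-1))

/-- Dual inequalities need testing only on generators, and each generator lies in one factor, so the
conditions decouple. -/
theorem polarDual_freeSum {a b : ℕ} (P : Set (Fin a → ℝ)) (Q : Set (Fin b → ℝ)) :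
    polarDual (freeSum P Q) = appendLinear a b '' (polarDual P ×ˢ polarDual Q) := by
  rw [freeSum, polarDual_convexHull]
  ext x
  constructor
  · intro h
    refine ⟨(fun i => x (Fin.castAdd b i), fun i => x (Fin.natAdd a i)), ⟨?_, ?_⟩, ?_⟩
    · intro y hy
      simpa [Fin.sum_univ_add] using h _ (Or.inl ⟨y, hy, rfl⟩)
    · intro y hy
      simpa [Fin.sum_univ_add] using h _ (Or.inr ⟨y, hy, rfl⟩)
    · exact Fin.append_castAdd_natAdd
  · rintro ⟨⟨p, q⟩, ⟨hp, hq⟩, rfl⟩ _ (⟨y, hy, rfl⟩ | ⟨y, hy, rfl⟩)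
    · simpa [Fin.sum_univ_add, appendLinear] using hp y hy
    · simpa [Fin.sum_univ_add, appendLinear] using hq y hy

theorem append_eq_add {a b : ℕ} (x : Fin a → ℝ) (y : Fin b → ℝ) :
    Fin.append x y = Fin.append x 0 + Fin.append 0 y := by
  ext i
  refine Fin.addCases ?_ ?_ i <;> simp

theorem smul_append {a b : ℕ} (c : ℝ) (x : Fin a → ℝ) (y : Fin b → ℝ) :
    c • Fin.append x y = Fin.append (c • x) (c • y) :=
  ((appendLinear a b).map_smul c (x, y)).symm

theorem convex_freeSum {a b : ℕ} (P : Set (Fin a → ℝ)) (Q : Set (Fin b → ℝ)) :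
    Convex ℝ (freeSum P Q) :=
  convex_convexHull ℝ _

theorem append_mem_smul_freeSum {a b : ℕ} {P : Set (Fin a → ℝ)} {Q : Set (Fin b → ℝ)} {s t : ℝ}
    (hs : 0 ≤ s) (ht : 0 ≤ t) {x : Fin a → ℝ} {y : Fin b → ℝ} (hx : x ∈ s • P) (hy : y ∈ t • Q) :
    Fin.append x y ∈ (s + t) • freeSum P Q := by
  rw [(convex_freeSum P Q).add_smul hs ht, append_eq_add]
  obtain ⟨p, hp, rfl⟩ := hx
  obtain ⟨q, hq, rfl⟩ := hy
  refine Set.add_mem_add ⟨_, append_left_mem_freeSum Q hp, ?_⟩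
    ⟨_, append_right_mem_freeSum P hq, ?_⟩ <;> simp [smul_append]

theorem exists_of_append_mem_smul_freeSum {a b : ℕ} {P : Set (Fin a → ℝ)} {Q : Set (Fin b → ℝ)}
    (hP : Convex ℝ P) (hQ : Convex ℝ Q) (hPne : P.Nonempty) (hQne : Q.Nonempty) {r : ℝ}
    (hr : 0 ≤ r) {x : Fin a → ℝ} {y : Fin b → ℝ} (h : Fin.append x y ∈ r • freeSum P Q) :
    ∃ s t, 0 ≤ s ∧ 0 ≤ t ∧ s + t = r ∧ x ∈ s • P ∧ y ∈ t • Q := by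
  obtain ⟨v, hv, hxy⟩ := h
  have hl : Convex ℝ ((fun x : Fin a → ℝ => Fin.append x (0 : Fin b → ℝ)) '' P) :=
    hP.linear_image ((appendLinear a b).comp (LinearMap.inl ℝ _ _))
  have hr' : Convex ℝ ((fun y : Fin b → ℝ => Fin.append (0 : Fin a → ℝ) y) '' Q) :=
    hQ.linear_image ((appendLinear a b).comp (LinearMap.inr ℝ _ _))
  rw [freeSum, convexHull_union (hPne.image _) (hQne.image _), hl.convexHull_eq,
    hr'.convexHull_eq, mem_convexJoin] at hv
  obtain ⟨_, ⟨p, hp, rfl⟩, _, ⟨q, hq, rfl⟩, s, t, hs, ht, hst, rfl⟩ := hv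
  refine ⟨r * s, r * t, mul_nonneg hr hs, mul_nonneg hr ht, by rw [← mul_add, hst, mul_one],
    ⟨p, hp, ?_⟩, ⟨q, hq, ?_⟩⟩
  · ext i
    simpa [mul_assoc] using congrFun hxy (Fin.castAdd b i)
  · ext i
    simpa [mul_assoc] using congrFun hxy (Fin.natAdd a i)

theorem zero_mem_interior_freeSum {a b : ℕ} {P : Set (Fin a → ℝ)} {Q : Set (Fin b → ℝ)}
    (hP : 0 ∈ interior P) (hQ : 0 ∈ interior Q) : 0 ∈ interior (freeSum P Q) := by
  rw [mem_interior_iff_mem_nhds] at *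
  -- The factor 2 compensates for the weight `1/2` given to each component below.
  have hl : Filter.Tendsto (fun (x : Fin (a + b) → ℝ) i => 2 * x (Fin.castAdd b i)) (𝓝 0) (𝓝 0) :=
    Continuous.tendsto' (by fun_prop) _ _ (by ext; simp)
  have hr : Filter.Tendsto (fun (x : Fin (a + b) → ℝ) i => 2 * x (Fin.natAdd a i)) (𝓝 0) (𝓝 0) :=
    Continuous.tendsto' (by fun_prop) _ _ (by ext; simp)
  filter_upwards [hl hP, hr hQ] with x hx hy
  have := append_mem_smul_freeSum (P := P) (Q := Q) (s := 2⁻¹) (t := 2⁻¹) (by norm_num)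
    (by norm_num) (Set.smul_mem_smul_set hx) (Set.smul_mem_smul_set hy)
  norm_num at this
  convert this using 1
  ext i
  refine Fin.addCases ?_ ?_ i <;> simp

theorem IsReflexive.freeSum {a b : ℕ} {P : Set (Fin a → ℝ)} {Q : Set (Fin b → ℝ)}
    (hP : IsReflexive P) (hQ : IsReflexive Q) : IsReflexive (freeSum P Q) where
  integral := hP.integral.freeSum hQ.integral
  zero_mem_interior := zero_mem_interior_freeSum hP.zero_mem_interior hQ.zero_mem_interior
  dual_integral := by
    rw [polarDual_freeSum]
    exact hP.dual_integral.appendLinear_image_prod hQ.dual_integral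

/-- `h` is the restriction to the lattice of the gauge of `Q`. -/
def IsLatticeGauge {d : ℕ} (Q : Set (Fin d → ℝ)) (h : (Fin d → ℤ) → ℕ) : Prop :=
  ∀ z, ∀ r : ℝ, 0 ≤ r → (latticePoint z ∈ r • Q ↔ (h z : ℝ) ≤ r)

/-- A point of `r(P ⊕ Q)` splits with weights `s + t = r` that need not be integers, which is why
lattice gauges are tested at all real `r ≥ 0`. -/
theorem IsLatticeGauge.freeSum {a b : ℕ} {P : Set (Fin a → ℝ)} {Q : Set (Fin b → ℝ)}
    {f : (Fin a → ℤ) → ℕ} {g : (Fin b → ℤ) → ℕ} (hP : IsReflexive P) (hQ : IsReflexive Q)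
    (hf : IsLatticeGauge P f) (hg : IsLatticeGauge Q g) :
    IsLatticeGauge (freeSum P Q)
      (fun z => f (fun i => z (Fin.castAdd b i)) + g (fun i => z (Fin.natAdd a i))) := by
  intro z r hr
  set x := fun i => z (Fin.castAdd b i)
  set y := fun i => z (Fin.natAdd a i)
  have hz : latticePoint z = Fin.append (latticePoint x) (latticePoint y) := by
    rw [← latticePoint_append, Fin.append_castAdd_natAdd]
  rw [hz, Nat.cast_add]
  constructor
  · intro h
    obtain ⟨s, t, hs, ht, hst, hx, hy⟩ := exists_of_append_mem_smul_freeSum hP.integral.convex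
      hQ.integral.convex ⟨0, interior_subset hP.zero_mem_interior⟩
      ⟨0, interior_subset hQ.zero_mem_interior⟩ hr h
    rw [← hst]
    exact add_le_add ((hf x s hs).1 hx) ((hg y t ht).1 hy)
  · intro h
    -- `P` receives exactly its gauge `f x`; all the slack goes to `Q`.
    have ht : (g y : ℝ) ≤ r - f x := by linarith
    have ht₀ : 0 ≤ r - f x := (Nat.cast_nonneg _).trans ht
    have := append_mem_smul_freeSum (Nat.cast_nonneg _) ht₀
      ((hf x _ (Nat.cast_nonneg _)).2 le_rfl) ((hg y _ ht₀).2 ht)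
    rwa [add_sub_cancel] at this

theorem IsLatticeGauge.latticeCount {d : ℕ} {Q : Set (Fin d → ℝ)} {h : (Fin d → ℤ) → ℕ}
    (hQ : IsLatticeGauge Q h) (k : ℕ) : latticeCount Q k = {z | h z ≤ k}.ncard := by
  unfold EhrhartCL.latticeCount
  congr 1
  ext z
  exact (hQ z k (Nat.cast_nonneg k)).trans Nat.cast_le

/-! ### The hexagon and the segment -/

theorem smul_add_smul_mem_of_zero_mem {E : Type*} [AddCommGroup E] [Module ℝ E] {K : Set E}
    (hK : Convex ℝ K) (h₀ : 0 ∈ K) {v w : E} (hv : v ∈ K) (hw : w ∈ K) {a b : ℝ} (ha : 0 ≤ a)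
    (hb : 0 ≤ b) (hab : a + b ≤ 1) : a • v + b • w ∈ K := by
  have h : a • v + b • w ∈ (a + b) • K := by
    rw [hK.add_smul ha hb]
    exact Set.add_mem_add (Set.smul_mem_smul_set hv) (Set.smul_mem_smul_set hw)
  obtain ⟨u, hu, h⟩ := h
  rw [← h]
  exact hK.smul_mem_of_zero_mem h₀ hu ⟨add_nonneg ha hb, hab⟩

/-- Lattice points spanning the hexagon `|x| ≤ 1, |y| ≤ 1, |x - εy| ≤ 1` when `ε = ±1`. -/
def hexVertices (ε : ℤ) : Set (Fin 2 → ℤ) :=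
  {![1, 0], ![0, ε], ![1, ε], ![-1, 0], ![0, -ε], ![-1, -ε]}

theorem finite_hexVertices (ε : ℤ) : (hexVertices ε).Finite := by
  unfold hexVertices
  exact Set.toFinite _

theorem nonempty_hexVertices (ε : ℤ) : (hexVertices ε).Nonempty := ⟨![1, 0], Or.inl rfl⟩

/-- The two signs give `A_2` and its polar dual. For the harder inclusion, the hexagon is cut into
six triangles with apex 0, each spanned by two adjacent vertices. -/
theorem convexHull_hexVertices {ε : ℤ} (hε : ε = 1 ∨ ε = -1) :
    convexHull ℝ (latticePoint '' hexVertices ε) =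
      {x : Fin 2 → ℝ | |x 0| ≤ 1 ∧ |x 1| ≤ 1 ∧ |x 0 - (ε : ℝ) * x 1| ≤ 1} := by
  have hsq : (ε : ℝ) * ε = 1 := by rcases hε with rfl | rfl <;> norm_num
  have habs : |(ε : ℝ)| = 1 := by rcases hε with rfl | rfl <;> norm_num
  apply Set.Subset.antisymm
  · apply convexHull_min
    · rintro _ ⟨v, hv, rfl⟩
      simp only [hexVertices, Set.mem_insert_iff, Set.mem_singleton_iff] at hv
      rcases hv with rfl | rfl | rfl | rfl | rfl | rfl <;> simp [latticePoint, hsq, habs]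
    · simp only [abs_le]
      intro x hx y hy a b ha hb hab
      obtain ⟨⟨h₁, h₂⟩, ⟨h₃, h₄⟩, h₅, h₆⟩ := hx
      obtain ⟨⟨k₁, k₂⟩, ⟨k₃, k₄⟩, k₅, k₆⟩ := hy
      obtain rfl : b = 1 - a := by linarith
      simp only [Set.mem_ofPred_eq, Pi.add_apply, Pi.smul_apply, smul_eq_mul]
      refine ⟨⟨?_, ?_⟩, ⟨?_, ?_⟩, ?_, ?_⟩ <;> nlinarith
  · rintro x ⟨h₁, h₂, h₃⟩
    set K := convexHull ℝ (latticePoint '' hexVertices ε)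
    have hK : Convex ℝ K := convex_convexHull ℝ _
    have hmem : ∀ v ∈ hexVertices ε, latticePoint v ∈ K := fun v hv =>
      subset_convexHull ℝ _ (Set.mem_image_of_mem _ hv)
    have hp := hmem ![1, 0] (by simp [hexVertices])
    have hq := hmem ![0, ε] (by simp [hexVertices])
    have hs := hmem ![1, ε] (by simp [hexVertices])
    have hp' := hmem ![-1, 0] (by simp [hexVertices])
    have hq' := hmem ![0, -ε] (by simp [hexVertices])
    have hs' := hmem ![-1, -ε] (by simp [hexVertices])
    have h₀ : 0 ∈ K := by
      convert hK hp hp' (a := 1 / 2) (b := 1 / 2) (by norm_num) (by norm_num) (by norm_num) using 1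
      ext i
      fin_cases i <;> simp [latticePoint]
    -- In the coordinates `(x 0, w)` the hexagon is the one for `ε = 1`.
    obtain ⟨w, hw⟩ : ∃ w, w = ε * x 1 := ⟨_, rfl⟩
    have hx₁ : x 1 = w * ε := by rw [hw]; linear_combination -x 1 * hsq
    have h₂' : |w| ≤ 1 := by rwa [hw, abs_mul, habs, one_mul]
    rw [← hw] at h₃
    rw [abs_le] at h₁ h₂' h₃
    have combine : ∀ (v v' : Fin 2 → ℤ) (a b : ℝ), latticePoint v ∈ K → latticePoint v' ∈ K →
        0 ≤ a → 0 ≤ b → a + b ≤ 1 → x 0 = a * v 0 + b * v' 0 → x 1 = a * v 1 + b * v' 1 →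
        x ∈ K := by
      intro v v' a b hv hv' ha hb hab hx hy
      convert smul_add_smul_mem_of_zero_mem hK h₀ hv hv' ha hb hab using 1
      ext i
      fin_cases i
      · simpa [latticePoint] using hx
      · simpa [latticePoint] using hy
    -- The signs of `x 0` and `w`, together with their order when the signs agree, select the
    -- triangle.
    rcases le_total 0 (x 0) with hu | hu <;> rcases le_total 0 w with hv | hv
    · rcases le_total w (x 0) with h | h
      · exact combine _ _ w (x 0 - w) hs hp hv (by linarith) (by linarith)
          (by simp) (by simp [hx₁])
      · exact combine _ _ (x 0) (w - x 0) hs hq hu (by linarith) (by linarith)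
          (by simp) (by simp [hx₁]; ring)
    · exact combine _ _ (x 0) (-w) hp hq' hu (by linarith) (by linarith)
        (by simp) (by simp [hx₁])
    · exact combine _ _ (-x 0) w hp' hq (by linarith) hv (by linarith)
        (by simp) (by simp [hx₁])
    · rcases le_total w (x 0) with h | h
      · exact combine _ _ (-x 0) (x 0 - w) hs' hq' (by linarith) (by linarith) (by linarith)
          (by simp) (by simp [hx₁]; ring)
      · exact combine _ _ (-w) (w - x 0) hs' hp' (by linarith) (by linarith) (by linarith)
          (by simp) (by simp [hx₁])

theorem rootPolytopeA_two :
    rootPolytopeA 2 = convexHull ℝ (latticePoint '' hexVertices 1) := by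
  unfold rootPolytopeA
  congr 1
  have h₀₁ : Finset.Icc (0 : Fin 2) 1 = {0, 1} := by decide
  have key : ∀ v : Fin 2 → ℝ, v ∈ latticePoint '' hexVertices 1 ↔
      (v = ![1, 0] ∨ v = ![0, 1] ∨ v = ![1, 1] ∨ v = ![-1, 0] ∨ v = ![0, -1] ∨ v = ![-1, -1]) := by
    intro v
    simp only [hexVertices, Set.image_insert_eq, Set.image_singleton, Set.mem_insert_iff,
      Set.mem_singleton_iff, latticePoint, funext_iff, Fin.forall_fin_two]
    simp
  ext v
  rw [key, Set.mem_ofPred_eq]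
  simp only [Fin.exists_fin_two, Finset.Icc_self, Finset.sum_singleton, h₀₁, funext_iff,
    Fin.forall_fin_two]
  simp
  tauto

/-- The vertices of each hexagon are the facet normals of the other. -/
theorem polarDual_rootPolytopeA_two :
    polarDual (rootPolytopeA 2) = convexHull ℝ (latticePoint '' hexVertices (-1)) := by
  rw [rootPolytopeA_two, polarDual_convexHull, convexHull_hexVertices (Or.inr rfl)]
  ext x
  simp only [hexVertices, Set.forall_mem_image, Set.mem_insert_iff, Set.mem_singleton_iff,
    forall_eq_or_imp, forall_eq, Set.mem_ofPred_eq, Fin.sum_univ_two, latticePoint, abs_le]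
  simp
  constructor
  · rintro ⟨h₁, h₂, h₃, h₄, h₅, h₆⟩
    refine ⟨⟨?_, ?_⟩, ⟨?_, ?_⟩, ?_, ?_⟩ <;> linarith
  · rintro ⟨⟨h₁, h₂⟩, ⟨h₃, h₄⟩, h₅, h₆⟩
    refine ⟨?_, ?_, ?_, ?_, ?_, ?_⟩ <;> linarith

theorem mem_rootPolytopeA_two {x : Fin 2 → ℝ} :
    x ∈ rootPolytopeA 2 ↔ max (max |x 0| |x 1|) |x 0 - x 1| ≤ 1 := by
  rw [rootPolytopeA_two, convexHull_hexVertices (Or.inl rfl)]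
  simp [and_assoc]

theorem convexHull_segmentVertices :
    convexHull ℝ (latticePoint '' ({![1], ![-1]} : Set (Fin 1 → ℤ))) = {x | |x 0| ≤ 1} := by
  rw [Set.image_pair, convexHull_pair]
  ext x
  rw [Set.mem_ofPred_eq, abs_le]
  constructor
  · rintro ⟨a, b, ha, hb, hab, rfl⟩
    simp [latticePoint]
    constructor <;> linarith
  · rintro ⟨h₁, h₂⟩
    refine ⟨(1 + x 0) / 2, (1 - x 0) / 2, by linarith, by linarith, by ring, ?_⟩
    ext i
    fin_cases i
    simp [latticePoint]
    ring

theorem rootPolytopeA_one :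
    rootPolytopeA 1 = convexHull ℝ (latticePoint '' ({![1], ![-1]} : Set (Fin 1 → ℤ))) := by
  unfold rootPolytopeA
  congr 1
  ext v
  have key : v ∈ latticePoint '' ({![1], ![-1]} : Set (Fin 1 → ℤ)) ↔ v = ![1] ∨ v = ![-1] := by
    simp only [Set.image_insert_eq, Set.image_singleton, Set.mem_insert_iff,
      Set.mem_singleton_iff, latticePoint, funext_iff, Fin.forall_fin_one]
    simp
  rw [key]
  simp [funext_iff]

theorem polarDual_rootPolytopeA_one : polarDual (rootPolytopeA 1) = rootPolytopeA 1 := by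
  rw [rootPolytopeA_one, polarDual_convexHull, convexHull_segmentVertices]
  ext x
  simp only [Set.forall_mem_image, Set.mem_insert_iff, Set.mem_singleton_iff,
    forall_eq_or_imp, forall_eq, Set.mem_ofPred_eq, Fin.sum_univ_one, latticePoint, abs_le]
  simp

theorem mem_rootPolytopeA_one {x : Fin 1 → ℝ} : x ∈ rootPolytopeA 1 ↔ |x 0| ≤ 1 := by
  rw [rootPolytopeA_one, convexHull_segmentVertices, Set.mem_ofPred_eq]

theorem zero_mem_interior_of_norm {d : ℕ} {Q : Set (Fin d → ℝ)} {N : (Fin d → ℝ) → ℝ}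
    (hQ : ∀ x, x ∈ Q ↔ N x ≤ 1) (hN : Continuous N) (h₀ : N 0 = 0) : 0 ∈ interior Q := by
  have hopen : IsOpen {x | N x < 1} := isOpen_lt hN continuous_const
  refine mem_interior.2 ⟨{x | N x < 1}, fun x hx => (hQ x).2 ?_, hopen, ?_⟩
  · rw [Set.mem_ofPred_eq] at hx
    exact hx.le
  · rw [Set.mem_ofPred_eq, h₀]
    exact zero_lt_one

theorem mem_smul_iff_of_norm {d : ℕ} {Q : Set (Fin d → ℝ)} {N : (Fin d → ℝ) → ℝ}
    (hQ : ∀ x, x ∈ Q ↔ N x ≤ 1) (hN : ∀ (c : ℝ) x, 0 ≤ c → N (c • x) = c * N x)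
    (hpos : ∀ x, N x ≤ 0 → x = 0) {r : ℝ} (hr : 0 ≤ r) (x : Fin d → ℝ) :
    x ∈ r • Q ↔ N x ≤ r := by
  have hN₀ : N 0 = 0 := by simpa using hN 0 0 le_rfl
  -- At `r = 0` the dilate is `{0}`, so definiteness of `N` is needed; for `r > 0` homogeneity
  -- suffices.
  rcases hr.eq_or_lt with rfl | hr
  · rw [Set.zero_smul_set ⟨0, (hQ 0).2 (by rw [hN₀]; exact zero_le_one)⟩]
    exact ⟨fun h => by rw [Set.mem_zero.1 h, hN₀], fun h => hpos x h⟩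
  · rw [Set.mem_smul_set_iff_inv_smul_mem₀ hr.ne', hQ, hN _ _ (inv_nonneg.2 hr.le),
      inv_mul_le_iff₀ hr, mul_one]

theorem isReflexive_rootPolytopeA_two : IsReflexive (rootPolytopeA 2) where
  integral := .of_finite (finite_hexVertices 1) (nonempty_hexVertices 1) rootPolytopeA_two
  zero_mem_interior :=
    zero_mem_interior_of_norm (fun _ => mem_rootPolytopeA_two) (by fun_prop) (by simp)
  dual_integral :=
    .of_finite (finite_hexVertices (-1)) (nonempty_hexVertices (-1)) polarDual_rootPolytopeA_two

theorem isLatticeGauge_rootPolytopeA_two : IsLatticeGauge (rootPolytopeA 2) hexGauge := by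
  intro z r hr
  rw [mem_smul_iff_of_norm (fun _ => mem_rootPolytopeA_two) ?_ ?_ hr]
  · simp [hexGauge, latticePoint, Nat.cast_natAbs, and_assoc]
  · intro c x hc
    simp only [Pi.smul_apply, smul_eq_mul, ← mul_sub, abs_mul, abs_of_nonneg hc,
      mul_max_of_nonneg _ _ hc]
  · intro x hx
    simp only [max_le_iff, abs_nonpos_iff] at hx
    ext i
    fin_cases i
    · exact hx.1.1
    · exact hx.1.2

theorem isReflexive_rootPolytopeA_one : IsReflexive (rootPolytopeA 1) := by
  have hint : IsIntegralPolytope (rootPolytopeA 1) :=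
    .of_finite (Set.toFinite _) (Set.insert_nonempty _ _) rootPolytopeA_one
  refine ⟨hint, ?_, by rwa [polarDual_rootPolytopeA_one]⟩
  exact zero_mem_interior_of_norm (fun _ => mem_rootPolytopeA_one) (by fun_prop) (by simp)

theorem isLatticeGauge_rootPolytopeA_one :
    IsLatticeGauge (rootPolytopeA 1) (fun z => (z 0).natAbs) := by
  intro z r hr
  rw [mem_smul_iff_of_norm (fun _ => mem_rootPolytopeA_one) ?_ ?_ hr]
  · simp [latticePoint, Nat.cast_natAbs]
  · intro c x hc
    simp [abs_mul, abs_of_nonneg hc]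
  · intro x hx
    ext i
    fin_cases i
    exact abs_nonpos_iff.1 hx

/-! ### Iterated free sums and the Ehrhart polynomial -/

theorem isReflexive_freeSumPow {d : ℕ} {Q : Set (Fin d → ℝ)} (hQ : IsReflexive Q) (n : ℕ) :
    IsReflexive (freeSumPow Q n) := by
  induction n with
  | zero =>
    have : IsEmpty (Fin (d * 0)) := Fin.isEmpty'
    have hint : IsIntegralPolytope ({0} : Set (Fin (d * 0) → ℝ)) :=
      .of_finite (Set.finite_singleton 0) (Set.singleton_nonempty 0)
        (by rw [Set.image_singleton, latticePoint_zero, convexHull_singleton])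
    have hdual : polarDual ({0} : Set (Fin (d * 0) → ℝ)) = {0} := by
      ext x
      simp [polarDual, Subsingleton.elim x 0]
    -- In `ℝ^0` the point is the whole space, so 0 is interior.
    have huniv : ({0} : Set (Fin (d * 0) → ℝ)) = Set.univ :=
      Set.eq_univ_of_forall fun x => Subsingleton.elim x 0
    exact ⟨hint, by simp [freeSumPow, huniv], by rwa [freeSumPow, hdual]⟩
  | succ n ih => exact ih.freeSum hQ

/-- The lattice gauge of the cross-polytope `freeSumPow (rootPolytopeA 1) n`. -/
def crossGauge : (n : ℕ) → (Fin (1 * n) → ℤ) → ℕ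
  | 0 => fun _ => 0
  | n + 1 => fun z =>
    crossGauge n (fun i => z (Fin.castAdd 1 i)) + (z (Fin.natAdd (1 * n) (0 : Fin 1))).natAbs

theorem isLatticeGauge_freeSumPow_rootPolytopeA_one (n : ℕ) :
    IsLatticeGauge (freeSumPow (rootPolytopeA 1) n) (crossGauge n) := by
  induction n with
  | zero =>
    have : IsEmpty (Fin (1 * 0)) := Fin.isEmpty'
    intro z r hr
    simp only [crossGauge, Nat.cast_zero, hr, iff_true]
    exact ⟨0, rfl, Subsingleton.elim _ _⟩
  | succ n ih =>
    exact ih.freeSum (isReflexive_freeSumPow isReflexive_rootPolytopeA_one n)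
      isReflexive_rootPolytopeA_one isLatticeGauge_rootPolytopeA_one

theorem finite_sublevel_equiv {α β : Type*} (e : α ≃ β) {h : β → ℕ} {k : ℕ}
    (hf : {b | h b ≤ k}.Finite) : {a | h (e a) ≤ k}.Finite :=
  hf.preimage e.injective.injOn

theorem ncard_sublevel_equiv {α β : Type*} (e : α ≃ β) (h : β → ℕ) (k : ℕ) :
    {a | h (e a) ≤ k}.ncard = {b | h b ≤ k}.ncard := by
  rw [← Set.ncard_image_of_injective _ e.injective]
  congr 1
  exact Set.image_preimage_eq {b | h b ≤ k} e.surjective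

/-- The sum of the lattice gauges of the hexagon and of the cross-polytope. -/
def hexCrossGauge (n : ℕ) (p : (Fin 2 → ℤ) × (Fin (1 * n) → ℤ)) : ℕ :=
  hexGauge p.1 + crossGauge n p.2

/-- Splitting off the last coordinate. -/
def hexCrossEquiv (n : ℕ) : (Fin 2 → ℤ) × (Fin (1 * (n + 1)) → ℤ) ≃
    ((Fin 2 → ℤ) × (Fin (1 * n) → ℤ)) × ℤ :=
  ((Equiv.refl _).prodCongr ((Fin.appendEquiv (1 * n) 1).symm.trans
    ((Equiv.refl _).prodCongr (Equiv.funUnique (Fin 1) ℤ)))).trans (Equiv.prodAssoc _ _ _).symm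

theorem hexCrossGauge_succ (n : ℕ) (p : (Fin 2 → ℤ) × (Fin (1 * (n + 1)) → ℤ)) :
    hexCrossGauge (n + 1) p =
      hexCrossGauge n (hexCrossEquiv n p).1 + (hexCrossEquiv n p).2.natAbs :=
  (Nat.add_assoc _ _ _).symm

theorem finite_hexCrossGauge_sublevel (n k : ℕ) : {p | hexCrossGauge n p ≤ k}.Finite := by
  induction n generalizing k with
  | zero =>
    have : IsEmpty (Fin (1 * 0)) := Fin.isEmpty'
    refine (finite_hexGauge_sublevel k).preimage (f := Prod.fst) fun p _ q _ h => ?_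
    exact Prod.ext h (Subsingleton.elim _ _)
  | succ n ih =>
    simp only [hexCrossGauge_succ]
    exact finite_sublevel_equiv (hexCrossEquiv n)
      (h := fun q => hexCrossGauge n q.1 + q.2.natAbs) (finite_sublevel_add_natAbs ih k)

/-- Both sides satisfy the same difference equation in `k` and equal 1 at `k = 0`; hence a nested
induction, on `n` and then on `k`. -/
theorem ncard_hexCrossGauge_sublevel (n k : ℕ) :
    ({p | hexCrossGauge n p ≤ k}.ncard : ℚ) = (hexCrossPoly n).eval (k : ℚ) := by
  induction n generalizing k with
  | zero =>
    have : IsEmpty (Fin (1 * 0)) := Fin.isEmpty'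
    rw [hexCrossPoly_zero_eval]
    have h := ncard_sublevel_equiv (Equiv.prodUnique (Fin 2 → ℤ) (Fin (1 * 0) → ℤ)) hexGauge k
    have h' := ncard_hexGauge_sublevel k
    rw [← h] at h'
    exact_mod_cast h'
  | succ n ih =>
    have hcard : ∀ k, {p | hexCrossGauge (n + 1) p ≤ k}.ncard =
        {q : _ × ℤ | hexCrossGauge n q.1 + q.2.natAbs ≤ k}.ncard := fun k => by
      simp only [hexCrossGauge_succ]
      exact ncard_sublevel_equiv (hexCrossEquiv n)
        (fun q => hexCrossGauge n q.1 + q.2.natAbs) k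
    rw [hcard]
    induction k with
    | zero =>
      rw [ncard_sublevel_add_natAbs_zero, ih, Nat.cast_zero, hexCrossPoly_eval_zero,
        hexCrossPoly_eval_zero]
    | succ k ihk =>
      rw [ncard_sublevel_add_natAbs_succ (finite_hexCrossGauge_sublevel n)]
      push_cast
      rw [ihk, ih, ih, hexCrossPoly_difference]
      push_cast
      ring

theorem isEhrhartPolynomial_hexCrossPoly (n : ℕ) :
    IsEhrhartPolynomial (freeSum (rootPolytopeA 2) (freeSumPow (rootPolytopeA 1) n))
      (hexCrossPoly n) := by
  intro k
  have hg := isLatticeGauge_rootPolytopeA_two.freeSum isReflexive_rootPolytopeA_two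
    (isReflexive_freeSumPow isReflexive_rootPolytopeA_one n)
    (isLatticeGauge_freeSumPow_rootPolytopeA_one n)
  rw [hg.latticeCount, ← ncard_hexCrossGauge_sublevel]
  exact congrArg _ (ncard_sublevel_equiv (Fin.appendEquiv 2 (1 * n)).symm (hexCrossGauge n) k).symm

end EhrhartCL

theorem mainTheorem9 (n : ℕ) (hn : 1 ≤ n) :
    EhrhartCL.IsCL
      (EhrhartCL.freeSum (EhrhartCL.rootPolytopeA 2)
        (EhrhartCL.freeSumPow (EhrhartCL.rootPolytopeA 1) n)) :=
  ⟨EhrhartCL.isReflexive_rootPolytopeA_two.freeSum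
      (EhrhartCL.isReflexive_freeSumPow EhrhartCL.isReflexive_rootPolytopeA_one n),
    EhrhartCL.hexCrossPoly n, EhrhartCL.isEhrhartPolynomial_hexCrossPoly n,
    fun _ hz => EhrhartCL.hexCrossPoly_root_re n hz⟩
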